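/- Let $M$ be a smooth manifold without boundary (Hausdorff, second countable) of dimension $n$, equipped with a Borel measure $\mu$ that is finite on compact sets. Let $\mathbf X=\{X_1,\dots,X_r\}$ be a Hörmander system on $M$: smooth real vector fields such that at every $x\in M$ the values at $x$ of the real Lie algebra of vector fields generated by $X_1,\dots,X_r$ fill the tangent space $T_xM$. Let $\mathcal L=-\sum_{j=1}^r X_j^2$ be the associated sub-Laplacian. Functions are complex-valued. For a word $w=(j_1,\dots,j_k)$ in $\{1,\dots,r\}$ write $X_w=X_{j_1}\cdots X_{j_k}$ and $|w|=k$. Assume: 1. (Sobolev embedding) there are $m\in\mathbb N_0$ and $C\ge 0$ such that $\|f\|_{L^\infty(\mu)}\le C\sum_{|w|\le m}\|X_w f\|_{L^2(\mu)}$ for all $f\in C_0^\infty(M)$; 2. $\mathcal L$, with domain (the classes of) the functions in $C_0^\infty(M)$, is a well-defined, non-negative and essentially self-adjoint operator on $L^2(M,\mu)$; its self-adjoint closure is again denoted by $\mathcal L$. Let $s\ge 1$, and let $\gamma^s_{\mathbf X,L^2}(M)$ be the set of all $\varphi\in C^\infty(M)$ for which there are $A,C>0$ such that for every $\alpha\in\mathbb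 N_0^r$ and every word $w$ in which each letter $k$ occurs exactly $\alpha_k$ times, $$\|X_w\varphi\|_{L^2(\mu)}\le C\,A^{|\alpha|}(\alpha!)^s .$$ Then $$\gamma^s_{\mathbf X,L^2}(M)\subset\Big\{\varphi\in C^\infty(M)\,:\,\exists D>0\ \text{ such that }\ \|e^{D\mathcal L^{1/(2s)}}\varphi\|_{L^2}<\infty\Big\}.$$ Here the operator is given by the spectral theorem: if $E$ is the projection-valued measure on $\mathbb R$ with $\mathcal L=\int\lambda\,dE_\lambda$, the condition means that $\varphi\in L^2(M,\mu)$ and $\|e^{D\mathcal L^{1/(2s)}}\varphi\|_{L^2}^2=\int e^{2D\lambda^{1/(2s)}}\,d(E_\lambda\varphi,\varphi)<\infty$. -/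

import Mathlib

open MeasureTheory Set Filter Topology
open scoped Manifold ContDiff

noncomputable section

namespace SubGevrey

/-! ### Spectral calculus of an unbounded self-adjoint operator -/

section Spectral

variable {H : Type*} [NormedAddCommGroup H] [InnerProductSpace ℂ H] [CompleteSpace H]

/-- A projection-valued measure on the Borel sets of the real line: each Borel set is sent to an
orthogonal projection, the whole line to the identity, and the assignment is countably additive
in the strong operator topology. (The values on non-measurable sets play no role.) -/
structure PVM (H : Type*) [NormedAddCommGroup H] [InnerProductSpace ℂ H] [CompleteSpace H] where
  proj : Set ℝ → H →L[ℂ] H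
  isStarProjection : ∀ S, MeasurableSet S → IsStarProjection (proj S)
  proj_univ : proj univ = 1
  hasSum : ∀ S : ℕ → Set ℝ, (∀ i, MeasurableSet (S i)) → Pairwise (Function.onFun Disjoint S) →
    ∀ u : H, HasSum (fun i => proj (S i) u) (proj (⋃ i, S i) u)

theorem PVM.re_inner_nonneg (E : PVM H) {S : Set ℝ} (hS : MeasurableSet S) (u : H) :
    0 ≤ (inner ℂ u (E.proj S u)).re := by
  have h := E.isStarProjection S hS
  have h1 : E.proj S (E.proj S u) = E.proj S u := by
    have := congrArg (fun T : H →L[ℂ] H => T u) h.isIdempotentElem.eq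
    simpa using this
  have h2 : inner ℂ u (E.proj S u) = inner ℂ (E.proj S u) (E.proj S u) := by
    have h3 := (ContinuousLinearMap.isSelfAdjoint_iff_isSymmetric.1 h.isSelfAdjoint)
      u (E.proj S u)
    have h4 : inner ℂ (E.proj S u) (E.proj S u) = inner ℂ u (E.proj S (E.proj S u)) := h3
    rw [h4, h1]
  rw [h2]
  exact inner_self_nonneg (𝕜 := ℂ) (x := E.proj S u)

theorem PVM.proj_empty (E : PVM H) (u : H) : E.proj ∅ u = 0 := by
  have h := E.hasSum (fun _ => ∅) (fun _ => MeasurableSet.empty)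
    (fun _ _ _ => by simp [Function.onFun]) u
  exact tendsto_nhds_unique tendsto_const_nhds h.summable.tendsto_atTop_zero

/-- The scalar spectral measure `S ↦ ⟨u, E(S) u⟩`, that is `d(E_λ u, u)`. -/
def PVM.scalarMeasure (E : PVM H) (u : H) : Measure ℝ :=
  Measure.ofMeasurable (fun S _ => ENNReal.ofReal (inner ℂ u (E.proj S u)).re)
    (by simp [E.proj_empty])
    (by
      intro S hS hd
      have h1 : HasSum (fun i => (inner ℂ u (E.proj (S i) u)).re)
          (inner ℂ u (E.proj (⋃ i, S i) u)).re :=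
        (Complex.reCLM.hasSum ((innerSL ℂ u).hasSum (E.hasSum S hS hd u)))
      rw [← h1.tsum_eq]
      exact ENNReal.ofReal_tsum_of_nonneg (fun i => E.re_inner_nonneg (hS i) u) h1.summable)

theorem PVM.scalarMeasure_apply (E : PVM H) (u : H) {S : Set ℝ} (hS : MeasurableSet S) :
    E.scalarMeasure u S = ENNReal.ofReal (inner ℂ u (E.proj S u)).re :=
  Measure.ofMeasurable_apply S hS

/-- `A = ∫ t dE(t)`: the domain of `A` is `{u | ∫ t² d(E_t u, u) < ∞}`, and
`⟨u, A u⟩ = ∫ t d(E_t u, u)` for all `u` in the domain (which determines `A` by polarization). -/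
def PVM.IsSpectralResolution (E : PVM H) (A : H →ₗ.[ℂ] H) : Prop :=
  (∀ u : H, u ∈ A.domain ↔ ∫⁻ t, ENNReal.ofReal (t ^ 2) ∂(E.scalarMeasure u) < ⊤) ∧
  ∀ u : A.domain,
    inner ℂ (u : H) (A u) = ((∫ t, t ∂(E.scalarMeasure (u : H)) : ℝ) : ℂ)

/-- `u` lies in the domain of `g(A) = ∫ g dE`, where `E` is the projection-valued measure of `A`:
the quantity `‖g(A) u‖² = ∫ |g(t)|² d(E_t u, u)` is finite. The existence of `E` is part of the
assertion. -/
def MemCalculusDomain (A : H →ₗ.[ℂ] H) (g : ℝ → ℝ) (u : H) : Prop :=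
  ∃ E : PVM H, E.IsSpectralResolution A ∧
    ∫⁻ t, ENNReal.ofReal (g t ^ 2) ∂(E.scalarMeasure u) < ⊤

/-- A densely defined operator whose closure is self-adjoint. -/
def IsEssentiallySelfAdjoint (A : H →ₗ.[ℂ] H) : Prop :=
  Dense (A.domain : Set H) ∧ IsSelfAdjoint A.closure

/-- `⟨A u, u⟩ ≥ 0` on the domain of `A`. -/
def IsNonnegative (A : H →ₗ.[ℂ] H) : Prop :=
  ∀ u : A.domain, 0 ≤ (inner ℂ (A u) (u : H)).re

end Spectral

/-! ### Vector fields on a manifold -/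

section Manifold

variable {n r : ℕ} {M : Type*} [TopologicalSpace M] [ChartedSpace (EuclideanSpace ℝ (Fin n)) M]

/-- The real Lie algebra of vector fields generated by a family `X` of vector fields. -/
inductive LieGenerated (X : Fin r → (x : M) → TangentSpace (𝓡 n) x) :
    ((x : M) → TangentSpace (𝓡 n) x) → Prop
  | base (j : Fin r) : LieGenerated X (X j)
  | zero : LieGenerated X 0
  | add {V W : (x : M) → TangentSpace (𝓡 n) x} :
      LieGenerated X V → LieGenerated X W → LieGenerated X (V + W)
  | smul (c : ℝ) {V : (x : M) → TangentSpace (𝓡 n) x} :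
      LieGenerated X V → LieGenerated X (c • V)
  | bracket {V W : (x : M) → TangentSpace (𝓡 n) x} :
      LieGenerated X V → LieGenerated X W → LieGenerated X (VectorField.mlieBracket (𝓡 n) V W)

variable (n r M) in
/-- A Hörmander system: smooth real vector fields `X₁, …, X_r` such that at each point the values
of the Lie algebra they generate fill the whole tangent space. -/
structure HormanderSystem [IsManifold (𝓡 n) ∞ M] where
  field : Fin r → (x : M) → TangentSpace (𝓡 n) x
  smooth : ∀ j, ContMDiff (𝓡 n) (𝓡 n).tangent ∞
    (fun x => (⟨x, field j x⟩ : TangentBundle (𝓡 n) M))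
  spanning : ∀ (x : M) (v : TangentSpace (𝓡 n) x), ∃ V, LieGenerated field V ∧ V x = v

variable [IsManifold (𝓡 n) ∞ M]

/-- Smooth complex-valued functions on `M`. -/
def IsSmooth (n : ℕ) {M : Type*} [TopologicalSpace M] [ChartedSpace (EuclideanSpace ℝ (Fin n)) M]
    (f : M → ℂ) : Prop :=
  ContMDiff (𝓡 n) 𝓘(ℝ, ℂ) ∞ f

/-- The derivative `V f` of a complex-valued function along a vector field. -/
def lieD (V : (x : M) → TangentSpace (𝓡 n) x) (f : M → ℂ) : M → ℂ :=
  fun x => mvfderiv (𝓡 n) f x (V x)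

/-- `Y₁ Y₂ ⋯ Y_k f` for the word `Y₁, …, Y_k` in the letters `X₁, …, X_r`. -/
def wordD (X : HormanderSystem n r M) : List (Fin r) → (M → ℂ) → M → ℂ
  | [], f => f
  | j :: w, f => lieD (X.field j) (wordD X w f)

/-- The sub-Laplacian `L = -∑ X_j²` as a differential operator on functions. -/
def lap (X : HormanderSystem n r M) (f : M → ℂ) : M → ℂ :=
  fun x => -∑ j, lieD (X.field j) (lieD (X.field j) f) x

theorem IsSmooth.lieD {V : (x : M) → TangentSpace (𝓡 n) x}
    (hV : ContMDiff (𝓡 n) (𝓡 n).tangent ∞ (fun x => (⟨x, V x⟩ : TangentBundle (𝓡 n) M)))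
    {f : M → ℂ} (hf : IsSmooth n f) : IsSmooth n (lieD V f) := by
  have h1 : ContMDiff (𝓡 n).tangent 𝓘(ℝ, ℂ).tangent ∞ (tangentMap (𝓡 n) 𝓘(ℝ, ℂ) f) :=
    ContMDiff.contMDiff_tangentMap hf (by simp)
  have h2 := (contMDiff_snd_tangentBundle_modelSpace (n := ∞) ℂ 𝓘(ℝ, ℂ)).comp (h1.comp hV)
  exact h2

theorem lieD_add {V : (x : M) → TangentSpace (𝓡 n) x} {f g : M → ℂ}
    (hf : IsSmooth n f) (hg : IsSmooth n g) : lieD V (f + g) = lieD V f + lieD V g := by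
  funext x
  have := mvfderiv_add (hf.mdifferentiableAt (by simp) (x := x))
    (hg.mdifferentiableAt (by simp) (x := x))
  simp [lieD, this]

theorem lieD_smul {V : (x : M) → TangentSpace (𝓡 n) x} {f : M → ℂ} (c : ℂ)
    (hf : IsSmooth n f) : lieD V (c • f) = c • lieD V f := by
  funext x
  have h := (hf.mdifferentiableAt (by simp) (x := x)).hasMFDerivAt
  have h2 : HasMFDerivAt 𝓘(ℝ, ℂ) 𝓘(ℝ, ℂ) (fun z : ℂ => c • z) (f x)
      (c • ContinuousLinearMap.id ℝ ℂ : ℂ →L[ℝ] ℂ) :=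
    ((hasFDerivAt_id (𝕜 := ℝ) (f x)).const_smul c).hasMFDerivAt
  have h3 := (h2.comp x h).mfderiv
  have h4 : mfderiv (𝓡 n) 𝓘(ℝ, ℂ) (c • f) x = _ := h3
  simp only [lieD, mvfderiv, Pi.smul_apply]
  rw [h4]
  rfl

theorem IsSmooth.lap_add (X : HormanderSystem n r M) {f g : M → ℂ}
    (hf : IsSmooth n f) (hg : IsSmooth n g) : lap X (f + g) = lap X f + lap X g := by
  funext x
  simp only [lap, Pi.add_apply]
  rw [← neg_add, ← Finset.sum_add_distrib]
  congr 1
  refine Finset.sum_congr rfl fun j _ => ?_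
  rw [lieD_add hf hg, lieD_add (hf.lieD (X.smooth j)) (hg.lieD (X.smooth j))]
  rfl

theorem IsSmooth.lap_smul (X : HormanderSystem n r M) (c : ℂ) {f : M → ℂ}
    (hf : IsSmooth n f) : lap X (c • f) = c • lap X f := by
  funext x
  simp only [lap, Pi.smul_apply]
  rw [smul_neg, Finset.smul_sum]
  congr 1
  refine Finset.sum_congr rfl fun j _ => ?_
  rw [lieD_smul c hf, lieD_smul c (hf.lieD (X.smooth j))]
  rfl

variable [MeasurableSpace M]

/-- The set of pairs `([f], [L f])` in `L²(M, μ) × L²(M, μ)`, for `f` smooth with compact support.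
-/
def lapGraph (X : HormanderSystem n r M) (μ : Measure M) :
    Submodule ℂ (Lp ℂ 2 μ × Lp ℂ 2 μ) where
  carrier := {p | ∃ f : M → ℂ, IsSmooth n f ∧ HasCompactSupport f ∧
    p.1 =ᵐ[μ] f ∧ p.2 =ᵐ[μ] lap X f}
  add_mem' := by
    rintro p q ⟨f, hf, hfc, hf1, hf2⟩ ⟨g, hg, hgc, hg1, hg2⟩
    refine ⟨f + g, hf.add hg, hfc.add hgc, (Lp.coeFn_add _ _).trans (hf1.add hg1), ?_⟩
    rw [hf.lap_add X hg]
    exact (Lp.coeFn_add _ _).trans (hf2.add hg2)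
  zero_mem' := by
    have h0 : IsSmooth n (0 : M → ℂ) := contMDiff_const
    refine ⟨0, h0, HasCompactSupport.zero, Lp.coeFn_zero _ _ _, ?_⟩
    have : lap X (0 : M → ℂ) = 0 := by simpa using h0.lap_smul X 0
    rw [this]
    exact Lp.coeFn_zero _ _ _
  smul_mem' := by
    rintro c p ⟨f, hf, hfc, hf1, hf2⟩
    refine ⟨c • f, ?_, hfc.smul_left (f := fun _ => c), ?_, ?_⟩
    · exact ((c • ContinuousLinearMap.id ℝ ℂ : ℂ →L[ℝ] ℂ).contDiff.contMDiff).comp hf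
    · exact (Lp.coeFn_smul _ _).trans (hf1.const_smul c)
    · rw [hf.lap_smul X c]
      exact (Lp.coeFn_smul _ _).trans (hf2.const_smul c)

/-- `L` does not depend on the representative: a test function that vanishes almost everywhere is
sent to a function that vanishes almost everywhere. (Automatic if `μ` charges every non-empty open
set.) -/
def LapWellDefined (X : HormanderSystem n r M) (μ : Measure M) : Prop :=
  ∀ f : M → ℂ, IsSmooth n f → HasCompactSupport f → f =ᵐ[μ] 0 → lap X f =ᵐ[μ] 0

/-- The sub-Laplacian as an unbounded operator on `L²(M, μ)` with domain the (classes of) smooth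
functions with compact support. Only meaningful under `LapWellDefined X μ`. -/
def lapOp (X : HormanderSystem n r M) (μ : Measure M) :
    Lp ℂ 2 μ →ₗ.[ℂ] Lp ℂ 2 μ :=
  (lapGraph X μ).toLinearPMap

/-- `L`, with domain the smooth functions with compact support, is an essentially self-adjoint
operator on `L²(M, μ)`. -/
structure LapEssentiallySelfAdjoint (X : HormanderSystem n r M) (μ : Measure M) : Prop where
  wellDefined : LapWellDefined X μ
  essentiallySelfAdjoint : IsEssentiallySelfAdjoint (lapOp X μ)

/-- The Sobolev embedding: for some order `m` and constant `C`, the `L^∞` norm of every test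
function is at most `C` times the sum of the `L²` norms of its derivatives along all the words of
length at most `m`. -/
def SobolevEmbedding (X : HormanderSystem n r M) (μ : Measure M) : Prop :=
  ∃ (m : ℕ) (C : NNReal), ∀ f : M → ℂ, IsSmooth n f → HasCompactSupport f →
    eLpNorm f ⊤ μ ≤
      C * ∑ k ∈ Finset.range (m + 1), ∑ w : Fin k → Fin r, eLpNorm (wordD X (List.ofFn w) f) 2 μ

/-- The `L²` sub-Laplacian Gevrey space of order `s`: here `∂^α` stands for each product
`Y₁ ⋯ Y_{|α|}` in which the letter `X_k` occurs exactly `α_k` times, in any order. -/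
def gevreyL2 (X : HormanderSystem n r M) (μ : Measure M) (s : ℝ) : Set (M → ℂ) :=
  {φ | IsSmooth n φ ∧ ∃ A C : ℝ, 0 < A ∧ 0 < C ∧ ∀ (α : Fin r → ℕ) (w : List (Fin r)),
    (∀ k, w.count k = α k) →
    eLpNorm (wordD X w φ) 2 μ ≤
      ENNReal.ofReal (C * A ^ (∑ k, α k) * ((∏ k, (α k).factorial : ℕ) : ℝ) ^ s)}

/-- Smooth functions `φ` with `‖e^{D L^{1/(2s)}} φ‖_{L²} < ∞` for some `D > 0`, where `L` denotes
the closure of the sub-Laplacian on test functions. -/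
def expSpace (X : HormanderSystem n r M) (μ : Measure M) (s : ℝ) :
    Set (M → ℂ) :=
  {φ | IsSmooth n φ ∧ ∃ D : ℝ, 0 < D ∧ ∃ u : Lp ℂ 2 μ, u =ᵐ[μ] φ ∧
    MemCalculusDomain (lapOp X μ).closure (fun t => Real.exp (D * t ^ (1 / (2 * s)))) u}

end Manifold

end SubGevrey

end

/-!
A non-negative self-adjoint operator `A` has the bounded self-adjoint resolvent `R = (1 + A)⁻¹`.
The continuous functional calculus of `R` and the Riesz–Markov–Kakutani theorem give spectral
measures on the spectrum of `R`, and their images under `x ↦ x⁻¹ - 1` give the projection-valued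
measure `E` of `A`, with moments `∫ t ^ (2k) d(E_t v, v) = ‖A ^ k v‖ ^ 2`. Since `exp y` is at most
four times the largest even term in the exponential series of `2y`, the bounds
`‖A ^ k v‖ ≤ C * B ^ k * (2k)! ^ s` on all moments make `exp (2 * D * t ^ (1 / (2s)))` integrable.

For `φ` in the Gevrey space, `L ^ k φ` is up to sign a sum of `r ^ k` words of length `2k` applied
to `φ`, which yields exactly such bounds. That `L ^ k φ` lies in the domain of the closure, although
it need not have compact support, follows from essential self-adjointness: it is enough to pair with
test functions, where a cutoff of `L ^ k φ` may be used instead.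
-/

noncomputable section

namespace SubGevrey

/-! ### Spectral measures of a representation of `C(K, ℝ)` -/

section IndicatorSum

open scoped symmDiff

variable {α ι E : Type*} [MeasurableSpace α] {ν : Measure α} [NormedAddCommGroup E]
  {p : ENNReal} {S : ι → Set α}

theorem indicatorConstLp_biUnion_finset (F : Finset ι) (hS : ∀ i, MeasurableSet (S i))
    (hd : Pairwise (Function.onFun Disjoint S)) (hν : ∀ i, ν (S i) ≠ ⊤)
    (hU : MeasurableSet (⋃ i ∈ F, S i)) (hνU : ν (⋃ i ∈ F, S i) ≠ ⊤) (c : E) :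
    indicatorConstLp p hU hνU c = ∑ i ∈ F, indicatorConstLp p (hS i) (hν i) c := by
  classical
  induction F using Finset.induction_on with
  | empty => simp
  | insert a F ha ih =>
    have hF : MeasurableSet (⋃ i ∈ F, S i) := F.measurableSet_biUnion fun i _ => hS i
    have hdis : Disjoint (S a) (⋃ i ∈ F, S i) :=
      disjoint_iUnion₂_right.2 fun i hi => hd fun h => ha (h ▸ hi)
    have hνF : ν (⋃ i ∈ F, S i) ≠ ⊤ :=
      ne_top_of_le_ne_top hνU (measure_mono (biUnion_mono (F.subset_insert a) fun _ _ => le_rfl))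
    rw [Finset.sum_insert ha, ← ih hF hνF,
      ← indicatorConstLp_disjoint_union (hS a) hF (hν a) hνF hdis]
    congr 1
    exact Finset.set_biUnion_insert a F S

theorem tendsto_measure_biUnion_finset_symmDiff [Countable ι] (hU : ν (⋃ i, S i) ≠ ⊤)
    (hS : ∀ i, MeasurableSet (S i)) (hd : Pairwise (Function.onFun Disjoint S)) :
    Tendsto (fun F : Finset ι => ν ((⋃ i ∈ F, S i) ∆ ⋃ i, S i)) atTop (𝓝 0) := by
  have htail := ENNReal.tendsto_tsum_compl_atTop_zero (measure_iUnion hd hS ▸ hU)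
  refine tendsto_of_tendsto_of_tendsto_of_le_of_le tendsto_const_nhds htail (fun _ => zero_le)
    fun F => ?_
  refine (measure_mono ?_).trans (measure_iUnion_le fun i : {i // i ∉ F} => S i)
  rw [symmDiff_of_le (iUnion₂_subset fun i _ => subset_iUnion S i)]
  rintro x ⟨hx, hxF⟩
  obtain ⟨i, hi⟩ := mem_iUnion.1 hx
  exact mem_iUnion.2 ⟨⟨i, fun hiF => hxF (mem_biUnion hiF hi)⟩, hi⟩

theorem hasSum_indicatorConstLp_iUnion [Countable ι] [Fact (1 ≤ p)] (hp : p ≠ ⊤)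
    (hS : ∀ i, MeasurableSet (S i)) (hd : Pairwise (Function.onFun Disjoint S))
    (hU : MeasurableSet (⋃ i, S i)) (hνU : ν (⋃ i, S i) ≠ ⊤) (c : E) :
    HasSum (fun i => indicatorConstLp p (hS i)
        (ne_top_of_le_ne_top hνU (measure_mono (subset_iUnion S i))) c)
      (indicatorConstLp p hU hνU c) := by
  have hF (F : Finset ι) : MeasurableSet (⋃ i ∈ F, S i) := F.measurableSet_biUnion fun i _ => hS i
  have hνF (F : Finset ι) : ν (⋃ i ∈ F, S i) ≠ ⊤ :=
    ne_top_of_le_ne_top hνU (measure_mono (iUnion₂_subset fun i _ => subset_iUnion S i))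
  have h := tendsto_indicatorConstLp_set (ht := hF) (hμt := hνF) (hs := hU) (hμs := hνU) (c := c)
    hp (tendsto_measure_biUnion_finset_symmDiff hνU hS hd)
  exact h.congr fun F => indicatorConstLp_biUnion_finset F hS hd _ (hF F) (hνF F) c

end IndicatorSum

section Representation

variable {H : Type*} [NormedAddCommGroup H] [InnerProductSpace ℂ H] [CompleteSpace H]

theorem ofReal_re_inner_of_isSelfAdjoint {T : H →L[ℂ] H} (hT : IsSelfAdjoint T) (u : H) :
    ((inner ℂ u (T u)).re : ℂ) = inner ℂ u (T u) := by
  rw [← Complex.conj_eq_iff_re, inner_conj_symm]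
  exact ContinuousLinearMap.isSelfAdjoint_iff_isSymmetric.1 hT u u

variable {K : Type*} [TopologicalSpace K]

theorem isSelfAdjoint_map (π : C(K, ℝ) →⋆ₐ[ℝ] (H →L[ℂ] H)) (f : C(K, ℝ)) :
    IsSelfAdjoint (π f) :=
  (IsSelfAdjoint.all f).map π

theorem inner_map_left (π : C(K, ℝ) →⋆ₐ[ℝ] (H →L[ℂ] H)) (f : C(K, ℝ)) (u v : H) :
    inner ℂ (π f u) v = inner ℂ u (π f v) :=
  ContinuousLinearMap.isSelfAdjoint_iff_isSymmetric.1 (isSelfAdjoint_map π f) u v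

theorem map_mul_apply (π : C(K, ℝ) →⋆ₐ[ℝ] (H →L[ℂ] H)) (f g : C(K, ℝ)) (u : H) :
    π (f * g) u = π f (π g u) := by
  rw [map_mul, mul_apply_eq_comp]

theorem inner_map_mul_self (π : C(K, ℝ) →⋆ₐ[ℝ] (H →L[ℂ] H)) (f : C(K, ℝ)) (u : H) :
    (inner ℂ u (π (f * f) u)).re = ‖π f u‖ ^ 2 := by
  rw [map_mul_apply, ← inner_map_left]
  exact inner_self_eq_norm_sq (𝕜 := ℂ) _

/-- The positive functional `f ↦ ⟨u, π(f) u⟩` on `C(K, ℝ)`, the input of the Riesz–Markov–Kakutani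
theorem. -/
def spectralFunctional (π : C(K, ℝ) →⋆ₐ[ℝ] (H →L[ℂ] H)) (u : H) :
    CompactlySupportedContinuousMap K ℝ →ₚ[ℝ] ℝ :=
  PositiveLinearMap.mk₀
    { toFun := fun f => (inner ℂ u (π f.toContinuousMap u)).re
      map_add' := fun f g => by
        have : (f + g).toContinuousMap = f.toContinuousMap + g.toContinuousMap := rfl
        rw [this, map_add, add_apply, inner_add_right, Complex.add_re]
      map_smul' := fun c f => by
        have : (c • f).toContinuousMap = c • f.toContinuousMap := rfl
        rw [this, map_smul, smul_apply, ← Complex.coe_smul, inner_smul_right,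
          Complex.re_ofReal_mul]
        rfl }
    (fun f hf => by
      let g : C(K, ℝ) := ⟨fun x => √(f x), by fun_prop⟩
      have hg : f.toContinuousMap = g * g := by
        ext x
        exact (Real.mul_self_sqrt (hf x)).symm
      change 0 ≤ (inner ℂ u (π f.toContinuousMap u)).re
      rw [hg, inner_map_mul_self]
      positivity)

variable [CompactSpace K] [TopologicalSpace.MetrizableSpace K] [MeasurableSpace K] [BorelSpace K]

/-- The spectral measure `ν_u` of `π` at `u`: the measure on `K` with `∫ f dν_u = ⟨u, π(f) u⟩`. -/
def spectralMeasure (π : C(K, ℝ) →⋆ₐ[ℝ] (H →L[ℂ] H)) (u : H) : Measure K :=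
  RealRMK.rieszMeasure (spectralFunctional π u)

instance (π : C(K, ℝ) →⋆ₐ[ℝ] (H →L[ℂ] H)) (u : H) : IsFiniteMeasure (spectralMeasure π u) := by
  unfold spectralMeasure
  infer_instance

theorem integral_spectralMeasure (π : C(K, ℝ) →⋆ₐ[ℝ] (H →L[ℂ] H)) (u : H) (f : C(K, ℝ)) :
    ∫ x, f x ∂(spectralMeasure π u) = (inner ℂ u (π f u)).re :=
  RealRMK.integral_rieszMeasure (spectralFunctional π u)
    (CompactlySupportedContinuousMap.continuousMapEquiv f)

theorem measureReal_spectralMeasure_univ (π : C(K, ℝ) →⋆ₐ[ℝ] (H →L[ℂ] H)) (u : H) :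
    (spectralMeasure π u).real univ = ‖u‖ ^ 2 := by
  have h := integral_spectralMeasure π u (1 * 1)
  rw [inner_map_mul_self, map_one] at h
  simpa using h

theorem norm_toLp_spectralMeasure (π : C(K, ℝ) →⋆ₐ[ℝ] (H →L[ℂ] H)) (u : H) (f : C(K, ℝ)) :
    ‖ContinuousMap.toLp 2 (spectralMeasure π u) ℝ f‖ = ‖π f u‖ := by
  refine (sq_eq_sq₀ (norm_nonneg _) (norm_nonneg _)).1 ?_
  rw [← real_inner_self_eq_norm_sq, ContinuousMap.inner_toLp, ← inner_map_mul_self,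
    ← integral_spectralMeasure]
  rfl

theorem spectralMeasure_map (π : C(K, ℝ) →⋆ₐ[ℝ] (H →L[ℂ] H)) (u : H) (φ : C(K, ℝ)) :
    spectralMeasure π (π φ u) =
      (spectralMeasure π u).withDensity fun x => ENNReal.ofReal (φ x ^ 2) := by
  have hfin : IsFiniteMeasure
      ((spectralMeasure π u).withDensity fun x => ENNReal.ofReal (φ x ^ 2)) :=
    isFiniteMeasure_withDensity_ofReal ((φ ^ 2).continuous.integrable_of_hasCompactSupport
      (HasCompactSupport.of_compactSpace _)).hasFiniteIntegral
  refine ext_of_forall_integral_eq_of_IsFiniteMeasure fun f => ?_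
  calc ∫ x, f x ∂(spectralMeasure π (π φ u))
      = (inner ℂ (π φ u) (π f.toContinuousMap (π φ u))).re :=
        integral_spectralMeasure π _ f.toContinuousMap
    _ = (inner ℂ u (π (φ * (f.toContinuousMap * φ)) u)).re := by
        rw [map_mul_apply, map_mul_apply, inner_map_left]
    _ = ∫ x, φ x * (f x * φ x) ∂(spectralMeasure π u) :=
        (integral_spectralMeasure π u (φ * (f.toContinuousMap * φ))).symm
    _ = _ := by
        rw [integral_withDensity_eq_integral_toReal_smul (by fun_prop) (by simp)]
        refine integral_congr_ae (ae_of_all _ fun x => ?_)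
        simp only [ENNReal.toReal_ofReal (sq_nonneg (φ x)), smul_eq_mul]
        ring

/-- The isometry `h ↦ h(π) u` from `L²(ν_u)` to `H` extending `f ↦ π(f) u`. -/
def spectralMap (π : C(K, ℝ) →⋆ₐ[ℝ] (H →L[ℂ] H)) (u : H) :
    Lp ℝ 2 (spectralMeasure π u) →L[ℝ] H :=
  LinearMap.extendOfNorm
    ({ toFun := fun f => π f u
       map_add' := fun f g => by rw [map_add, add_apply]
       map_smul' := fun c f => by rw [map_smul, smul_apply, RingHom.id_apply] } : C(K, ℝ) →ₗ[ℝ] H)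
    (ContinuousMap.toLp 2 (spectralMeasure π u) ℝ).toLinearMap

theorem denseRange_toLp (ν : Measure K) [IsFiniteMeasure ν] :
    DenseRange (ContinuousMap.toLp (E := ℝ) 2 ν ℝ) :=
  ContinuousMap.toLp_denseRange ℝ _ _ (by simp)

theorem spectralMap_toLp (π : C(K, ℝ) →⋆ₐ[ℝ] (H →L[ℂ] H)) (u : H) (f : C(K, ℝ)) :
    spectralMap π u (ContinuousMap.toLp 2 (spectralMeasure π u) ℝ f) = π f u :=
  LinearMap.extendOfNorm_eq (denseRange_toLp _)
    ⟨1, fun f => (norm_toLp_spectralMeasure π u f).ge.trans_eq (one_mul _).symm⟩ f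

theorem norm_spectralMap (π : C(K, ℝ) →⋆ₐ[ℝ] (H →L[ℂ] H)) (u : H)
    (h : Lp ℝ 2 (spectralMeasure π u)) : ‖spectralMap π u h‖ = ‖h‖ := by
  refine (denseRange_toLp _).induction_on h (isClosed_eq (by fun_prop) (by fun_prop)) fun f => ?_
  rw [spectralMap_toLp, norm_toLp_spectralMeasure]

theorem map_spectralMap (π : C(K, ℝ) →⋆ₐ[ℝ] (H →L[ℂ] H)) (u : H) (φ : C(K, ℝ))
    {h h' : Lp ℝ 2 (spectralMeasure π u)} (hh : h' =ᵐ[spectralMeasure π u] fun x => φ x * h x) :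
    π φ (spectralMap π u h) = spectralMap π u h' := by
  let B := ContinuousLinearMap.mul ℝ ℝ
  let ν := spectralMeasure π u
  let mulφ : Lp ℝ 2 ν →L[ℝ] Lp ℝ 2 ν := B.holderL ν ⊤ 2 2 (ContinuousMap.toLp ⊤ ν ℝ φ)
  have hmul (g : Lp ℝ 2 ν) : mulφ g =ᵐ[ν] fun x => φ x * g x := by
    filter_upwards [B.coeFn_holder (r := 2) (ContinuousMap.toLp ⊤ ν ℝ φ) g,
      ContinuousMap.coeFn_toLp (p := ⊤) (𝕜 := ℝ) ν φ] with x h1 h2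
    rw [← h2]
    exact h1
  rw [Lp.ext (hh.trans (hmul h).symm)]
  refine (denseRange_toLp ν).induction_on h (isClosed_eq (by fun_prop) (by fun_prop)) fun f => ?_
  have hf : mulφ (ContinuousMap.toLp 2 ν ℝ f) = ContinuousMap.toLp 2 ν ℝ (φ * f) := by
    refine Lp.ext ((hmul _).trans ?_)
    filter_upwards [ContinuousMap.coeFn_toLp (p := 2) (𝕜 := ℝ) ν f,
      ContinuousMap.coeFn_toLp (p := 2) (𝕜 := ℝ) ν (φ * f)] with x h1 h2
    rw [h1, h2, ContinuousMap.mul_apply]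
  rw [hf, spectralMap_toLp, spectralMap_toLp, map_mul_apply]

end Representation

section SpectralProjections

variable {H : Type*} [NormedAddCommGroup H] [InnerProductSpace ℂ H] [CompleteSpace H]

theorem isStarProjection_of_norm_sq_eq {T : H →L[ℂ] H} (hT : IsSelfAdjoint T)
    (h : ∀ u, ‖T u‖ ^ 2 = (inner ℂ u (T u)).re) : IsStarProjection T := by
  have hsymm := ContinuousLinearMap.isSelfAdjoint_iff_isSymmetric.1 hT
  refine ⟨ContinuousLinearMap.coe_injective ((ext_inner_map _ _).1 fun u => ?_), hT⟩
  calc inner ℂ (T (T u)) u = inner ℂ (T u) (T u) := hsymm _ _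
    _ = ((inner ℂ u (T u)).re : ℂ) := by
        rw [inner_self_eq_norm_sq_to_K, ← h u]
        norm_cast
    _ = inner ℂ (T u) u := (ofReal_re_inner_of_isSelfAdjoint hT u).trans (hsymm u u).symm

variable {K : Type*} [TopologicalSpace K] [CompactSpace K] [TopologicalSpace.MetrizableSpace K]
  [MeasurableSpace K] [BorelSpace K]

theorem re_inner_spectralMap (π : C(K, ℝ) →⋆ₐ[ℝ] (H →L[ℂ] H)) (u : H)
    (h h' : Lp ℝ 2 (spectralMeasure π u)) :
    (inner ℂ (spectralMap π u h) (spectralMap π u h')).re = inner ℝ h h' := by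
  let _ : InnerProductSpace ℝ H := InnerProductSpace.complexToReal
  exact (LinearMap.norm_map_iff_inner_map_map (spectralMap π u)).1 (norm_spectralMap π u) h h'

variable {S : Set K}

/-- The vector `1_S(π) u`. -/
def spectralCut (π : C(K, ℝ) →⋆ₐ[ℝ] (H →L[ℂ] H)) (hS : MeasurableSet S) (u : H) : H :=
  spectralMap π u (indicatorConstLp 2 hS (measure_ne_top _ S) 1)

theorem spectralCut_univ (π : C(K, ℝ) →⋆ₐ[ℝ] (H →L[ℂ] H)) (u : H) :
    spectralCut π MeasurableSet.univ u = u := by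
  have h : indicatorConstLp 2 MeasurableSet.univ (measure_ne_top _ _) (1 : ℝ)
      = ContinuousMap.toLp 2 (spectralMeasure π u) ℝ 1 := by
    refine Lp.ext (indicatorConstLp_coeFn.trans ?_)
    filter_upwards [ContinuousMap.coeFn_toLp (p := 2) (𝕜 := ℝ) (spectralMeasure π u)
      (1 : C(K, ℝ))] with x hx
    rw [hx, indicator_univ, ContinuousMap.one_apply]
  rw [spectralCut, h, spectralMap_toLp, map_one, one_apply_eq_self]

theorem norm_spectralCut_sq (π : C(K, ℝ) →⋆ₐ[ℝ] (H →L[ℂ] H)) (hS : MeasurableSet S) (u : H) :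
    ‖spectralCut π hS u‖ ^ 2 = (spectralMeasure π u).real S := by
  rw [← inner_self_eq_norm_sq (𝕜 := ℂ), RCLike.re_to_complex, spectralCut, re_inner_spectralMap,
    L2.real_inner_indicatorConstLp_one_indicatorConstLp_one, inter_self]

theorem re_inner_spectralCut (π : C(K, ℝ) →⋆ₐ[ℝ] (H →L[ℂ] H)) (hS : MeasurableSet S) (u : H) :
    (inner ℂ u (spectralCut π hS u)).re = (spectralMeasure π u).real S := by
  nth_rewrite 1 [← spectralCut_univ π u]
  rw [spectralCut, spectralCut, re_inner_spectralMap,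
    L2.real_inner_indicatorConstLp_one_indicatorConstLp_one, univ_inter]

theorem enorm_map_sub_spectralCut (π : C(K, ℝ) →⋆ₐ[ℝ] (H →L[ℂ] H)) (hS : MeasurableSet S) (u : H)
    (f : C(K, ℝ)) :
    ‖π f u - spectralCut π hS u‖ₑ
      = eLpNorm (⇑f - S.indicator fun _ => (1 : ℝ)) 2 (spectralMeasure π u) := by
  rw [spectralCut, ← spectralMap_toLp, ← map_sub, ← ofReal_norm, norm_spectralMap,
    ofReal_norm, Lp.enorm_def]
  exact eLpNorm_congr_ae ((Lp.coeFn_sub _ _).trans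
    ((ContinuousMap.coeFn_toLp _ f).sub indicatorConstLp_coeFn))

theorem exists_tendsto_eLpNorm_sub_indicator (ν : Measure K) [IsFiniteMeasure ν]
    (hS : MeasurableSet S) :
    ∃ f : ℕ → C(K, ℝ),
      Tendsto (fun n => eLpNorm (⇑(f n) - S.indicator fun _ => (1 : ℝ)) 2 ν) atTop (𝓝 0) := by
  obtain ⟨x, hx, hl⟩ := mem_closure_iff_seq_limit.1
    (denseRange_toLp ν (indicatorConstLp 2 hS (measure_ne_top ν S) 1))
  choose f hf using hx
  refine ⟨f, (tendsto_iff_edist_tendsto_0.1 hl).congr fun n => ?_⟩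
  rw [← hf, edist_eq_enorm_sub, Lp.enorm_def]
  exact eLpNorm_congr_ae ((Lp.coeFn_sub _ _).trans
    ((ContinuousMap.coeFn_toLp _ (f n)).sub indicatorConstLp_coeFn))

/- Approximating in `L²` of the sum of the spectral measures makes one sequence work for all the
vectors at once; this is what transfers linearity and symmetry from `π f` to `1_S(π)`. -/
theorem exists_tendsto_spectralCut (π : C(K, ℝ) →⋆ₐ[ℝ] (H →L[ℂ] H)) (hS : MeasurableSet S)
    (F : Finset H) :
    ∃ f : ℕ → C(K, ℝ), ∀ u ∈ F, Tendsto (fun n => π (f n) u) atTop (𝓝 (spectralCut π hS u)) := by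
  obtain ⟨f, hf⟩ :=
    exists_tendsto_eLpNorm_sub_indicator (Measure.sum fun u : F => spectralMeasure π u.1) hS
  refine ⟨f, fun u hu => tendsto_iff_edist_tendsto_0.2 ?_⟩
  refine tendsto_of_tendsto_of_tendsto_of_le_of_le tendsto_const_nhds hf (fun _ => zero_le)
    fun n => ?_
  rw [edist_eq_enorm_sub, enorm_map_sub_spectralCut]
  exact eLpNorm_mono_measure _ (Measure.le_sum (fun u : F => spectralMeasure π u.1) ⟨u, hu⟩)

theorem spectralCut_add (π : C(K, ℝ) →⋆ₐ[ℝ] (H →L[ℂ] H)) (hS : MeasurableSet S) (u v : H) :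
    spectralCut π hS (u + v) = spectralCut π hS u + spectralCut π hS v := by
  classical
  obtain ⟨f, hf⟩ := exists_tendsto_spectralCut π hS {u, v, u + v}
  refine tendsto_nhds_unique (hf (u + v) (by simp))
    (((hf u (by simp)).add (hf v (by simp))).congr fun n => ?_)
  rw [map_add]

theorem spectralCut_smul (π : C(K, ℝ) →⋆ₐ[ℝ] (H →L[ℂ] H)) (hS : MeasurableSet S) (c : ℂ) (u : H) :
    spectralCut π hS (c • u) = c • spectralCut π hS u := by
  classical
  obtain ⟨f, hf⟩ := exists_tendsto_spectralCut π hS {u, c • u}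
  refine tendsto_nhds_unique (hf (c • u) (by simp)) (((hf u (by simp)).const_smul c).congr
    fun n => ?_)
  rw [map_smul]

theorem norm_spectralCut_le (π : C(K, ℝ) →⋆ₐ[ℝ] (H →L[ℂ] H)) (hS : MeasurableSet S) (u : H) :
    ‖spectralCut π hS u‖ ≤ ‖u‖ := by
  refine (sq_le_sq₀ (norm_nonneg _) (norm_nonneg _)).1 ?_
  rw [norm_spectralCut_sq, ← measureReal_spectralMeasure_univ π]
  exact measureReal_mono (subset_univ S)

/-- The spectral projection `1_S(π)`. -/
def spectralProj (π : C(K, ℝ) →⋆ₐ[ℝ] (H →L[ℂ] H)) (hS : MeasurableSet S) : H →L[ℂ] H :=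
  LinearMap.mkContinuous
    { toFun := spectralCut π hS
      map_add' := spectralCut_add π hS
      map_smul' := spectralCut_smul π hS }
    1 (fun u => (norm_spectralCut_le π hS u).trans_eq (one_mul _).symm)

theorem spectralProj_apply (π : C(K, ℝ) →⋆ₐ[ℝ] (H →L[ℂ] H)) (hS : MeasurableSet S) (u : H) :
    spectralProj π hS u = spectralCut π hS u := rfl

theorem isSelfAdjoint_spectralProj (π : C(K, ℝ) →⋆ₐ[ℝ] (H →L[ℂ] H)) (hS : MeasurableSet S) :
    IsSelfAdjoint (spectralProj π hS) := by
  classical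
  refine ContinuousLinearMap.isSelfAdjoint_iff_isSymmetric.2 fun u v => ?_
  obtain ⟨f, hf⟩ := exists_tendsto_spectralCut π hS {u, v}
  have hu := (hf u (by simp)).inner (𝕜 := ℂ) (tendsto_const_nhds (x := v))
  have hv := (tendsto_const_nhds (x := u)).inner (𝕜 := ℂ) (hf v (by simp))
  exact tendsto_nhds_unique hu (hv.congr fun n => (inner_map_left π (f n) u v).symm)

theorem isStarProjection_spectralProj (π : C(K, ℝ) →⋆ₐ[ℝ] (H →L[ℂ] H)) (hS : MeasurableSet S) :
    IsStarProjection (spectralProj π hS) :=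
  isStarProjection_of_norm_sq_eq (isSelfAdjoint_spectralProj π hS) fun u => by
    rw [spectralProj_apply, norm_spectralCut_sq, re_inner_spectralCut]

open scoped Classical in
/-- The projection-valued measure `S ↦ 1_{g⁻¹ S}(π)` of `g(π)`, for a Borel function `g` on `K`;
it is set to `0` on non-measurable sets. -/
def spectralPVM (π : C(K, ℝ) →⋆ₐ[ℝ] (H →L[ℂ] H)) {g : K → ℝ} (hg : Measurable g) : PVM H where
  proj S := if hS : MeasurableSet S then spectralProj π (hg hS) else 0
  isStarProjection S hS := by
    rw [dif_pos hS]
    exact isStarProjection_spectralProj π (hg hS)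
  proj_univ := by
    rw [dif_pos MeasurableSet.univ]
    ext u
    exact spectralCut_univ π u
  hasSum S hS hd u := by
    rw [dif_pos (MeasurableSet.iUnion hS)]
    simp only [dif_pos (hS _), spectralProj_apply, spectralCut, preimage_iUnion]
    exact (spectralMap π u).hasSum (hasSum_indicatorConstLp_iUnion (by simp) (fun i => hg (hS i))
      (fun i j hij => (hd hij).preimage g) _ (measure_ne_top _ _) 1)

theorem scalarMeasure_spectralPVM (π : C(K, ℝ) →⋆ₐ[ℝ] (H →L[ℂ] H)) {g : K → ℝ} (hg : Measurable g)
    (u : H) : (spectralPVM π hg).scalarMeasure u = (spectralMeasure π u).map g := by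
  ext S hS
  have hproj : (spectralPVM π hg).proj S = spectralProj π (hg hS) := dif_pos hS
  rw [PVM.scalarMeasure_apply _ _ hS, hproj, spectralProj_apply, re_inner_spectralCut,
    Measure.map_apply hg hS, ofReal_measureReal]

end SpectralProjections

/-! ### Operators with a bounded self-adjoint resolvent -/

section Resolvent

variable {H : Type*} [NormedAddCommGroup H] [InnerProductSpace ℂ H]

/-- The function `x ↦ x⁻¹ - 1`, which recovers `A` from `(1 + A)⁻¹`. -/
def invSubOne {S : Set ℝ} (x : S) : ℝ := (x : ℝ)⁻¹ - 1

theorem measurable_invSubOne {S : Set ℝ} : Measurable (invSubOne (S := S)) :=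
  measurable_subtype_coe.inv.sub_const 1

/-- The coordinate function on the spectrum of `R`. -/
def spectrumCoord (R : H →L[ℂ] H) : C(spectrum ℝ R, ℝ) :=
  (ContinuousMap.id ℝ).restrict (spectrum ℝ R)

@[simp]
theorem spectrumCoord_apply (R : H →L[ℂ] H) (x : spectrum ℝ R) : spectrumCoord R x = x := rfl

variable [CompleteSpace H]

theorem cfcHom_spectrumCoord {R : H →L[ℂ] H} (hR : IsSelfAdjoint R) :
    cfcHom hR (spectrumCoord R) = R :=
  cfcHom_id hR

/-- `R = (1 + A)⁻¹` is a bounded self-adjoint operator; the inverse is encoded through the graph of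
`A`, since `w = A u` if and only if `R (u + w) = u`. -/
structure IsSelfAdjointResolvent (A : H →ₗ.[ℂ] H) (R : H →L[ℂ] H) : Prop where
  isSelfAdjoint : IsSelfAdjoint R
  mem_graph_iff : ∀ u w, (u, w) ∈ A.graph ↔ R (u + w) = u

namespace IsSelfAdjointResolvent

variable {A : H →ₗ.[ℂ] H} {R : H →L[ℂ] H} (hA : IsSelfAdjointResolvent A R)

include hA

theorem eq_zero {f : H} (hf : R f = 0) : f = 0 :=
  A.graph_fst_eq_zero_snd ((hA.mem_graph_iff 0 f).2 (by rw [zero_add, hf])) rfl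

theorem ae_ne_zero (u : H) :
    ∀ᵐ x : spectrum ℝ R ∂(spectralMeasure (cfcHom hA.isSelfAdjoint) u), (x : ℝ) ≠ 0 := by
  set π := cfcHom (R := ℝ) hA.isSelfAdjoint
  have hS : MeasurableSet {x : spectrum ℝ R | (x : ℝ) = 0} :=
    measurable_subtype_coe (measurableSet_singleton 0)
  have hcut : R (spectralCut π hS u) = 0 := by
    have h := map_spectralMap π u (spectrumCoord R)
      (h := indicatorConstLp 2 hS (measure_ne_top _ _) 1) (h' := 0) (by
        filter_upwards [Lp.coeFn_zero ℝ 2 (spectralMeasure π u),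
          indicatorConstLp_coeFn (p := 2) (hs := hS)
            (hμs := measure_ne_top (spectralMeasure π u) _) (c := (1 : ℝ))] with x h1 h2
        rw [h1, h2]
        by_cases hx : (x : ℝ) = 0 <;> simp [hx])
    rwa [cfcHom_spectrumCoord, map_zero] at h
  have hnorm := norm_spectralCut_sq π hS u
  rw [hA.eq_zero hcut, norm_zero, zero_pow two_ne_zero, eq_comm, measureReal_eq_zero_iff] at hnorm
  simpa [ae_iff] using hnorm

theorem eq_cfcHom_spectrumCoord {u w : H} (huw : (u, w) ∈ A.graph) :
    cfcHom hA.isSelfAdjoint (spectrumCoord R) (u + w) = u := by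
  rw [cfcHom_spectrumCoord, (hA.mem_graph_iff u w).1 huw]

theorem eq_cfcHom_one_sub_spectrumCoord {u w : H} (huw : (u, w) ∈ A.graph) :
    cfcHom hA.isSelfAdjoint (1 - spectrumCoord R) (u + w) = w := by
  rw [map_sub, map_one, sub_apply, hA.eq_cfcHom_spectrumCoord huw, one_apply_eq_self,
    add_sub_cancel_left]

theorem spectralMeasure_of_mem_graph {u w : H} (huw : (u, w) ∈ A.graph) :
    spectralMeasure (cfcHom hA.isSelfAdjoint) w =
      (spectralMeasure (cfcHom hA.isSelfAdjoint) u).withDensity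
        fun x => ENNReal.ofReal (invSubOne x ^ 2) := by
  have hg : Measurable (invSubOne (S := spectrum ℝ R)) := measurable_invSubOne
  have hu := spectralMeasure_map (cfcHom hA.isSelfAdjoint) (u + w) (spectrumCoord R)
  have hw := spectralMeasure_map (cfcHom hA.isSelfAdjoint) (u + w) (1 - spectrumCoord R)
  rw [hA.eq_cfcHom_spectrumCoord huw] at hu
  rw [hA.eq_cfcHom_one_sub_spectrumCoord huw] at hw
  rw [hu, hw, ← withDensity_mul _ (by fun_prop) (by fun_prop)]
  refine withDensity_congr_ae ?_
  filter_upwards [hA.ae_ne_zero (u + w)] with x hx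
  rw [Pi.mul_apply, ← ENNReal.ofReal_mul (sq_nonneg _), ← mul_pow]
  simp only [ContinuousMap.sub_apply, ContinuousMap.one_apply, spectrumCoord_apply, invSubOne,
    mul_sub, mul_inv_cancel₀ hx, mul_one]

theorem spectralMeasure_orbit {v : ℕ → H} (hv : ∀ k, (v k, v (k + 1)) ∈ A.graph) (k : ℕ) :
    spectralMeasure (cfcHom hA.isSelfAdjoint) (v k) =
      (spectralMeasure (cfcHom hA.isSelfAdjoint) (v 0)).withDensity
        fun x => ENNReal.ofReal (invSubOne x ^ (2 * k)) := by
  have hg : Measurable (invSubOne (S := spectrum ℝ R)) := measurable_invSubOne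
  induction k with
  | zero => simp
  | succ k ih =>
    rw [hA.spectralMeasure_of_mem_graph (hv k), ih,
      ← withDensity_mul _ (by fun_prop) (by fun_prop)]
    congr 1
    ext x
    rw [Pi.mul_apply, ← ENNReal.ofReal_mul (by rw [pow_mul]; positivity), ← pow_add, mul_add_one]

/-- The projection-valued measure of `A`. -/
def pvm : PVM H := spectralPVM (cfcHom hA.isSelfAdjoint) measurable_invSubOne

theorem lintegral_scalarMeasure_pvm (u : H) {h : ℝ → ENNReal} (hh : Measurable h) :
    ∫⁻ t, h t ∂(hA.pvm.scalarMeasure u)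
      = ∫⁻ x, h (invSubOne x) ∂(spectralMeasure (cfcHom hA.isSelfAdjoint) u) := by
  rw [pvm, scalarMeasure_spectralPVM, lintegral_map hh measurable_invSubOne]

theorem lintegral_pow_scalarMeasure_pvm {v : ℕ → H} (hv : ∀ k, (v k, v (k + 1)) ∈ A.graph)
    (k : ℕ) :
    ∫⁻ t, ENNReal.ofReal (t ^ (2 * k)) ∂(hA.pvm.scalarMeasure (v 0))
      = ENNReal.ofReal (‖v k‖ ^ 2) := by
  rw [hA.lintegral_scalarMeasure_pvm _ (by fun_prop), ← setLIntegral_univ,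
    ← withDensity_apply _ MeasurableSet.univ, ← hA.spectralMeasure_orbit hv,
    ← measureReal_spectralMeasure_univ (cfcHom hA.isSelfAdjoint), ofReal_measureReal]

theorem lintegral_sq_lt_top_of_mem_graph {u w : H} (huw : (u, w) ∈ A.graph) :
    ∫⁻ t, ENNReal.ofReal (t ^ 2) ∂(hA.pvm.scalarMeasure u) < ⊤ := by
  rw [hA.lintegral_scalarMeasure_pvm _ (by fun_prop), ← setLIntegral_univ,
    ← withDensity_apply _ MeasurableSet.univ, ← hA.spectralMeasure_of_mem_graph huw]
  exact measure_lt_top _ _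

theorem mem_domain_of_lintegral_sq_lt_top {u : H}
    (hu : ∫⁻ t, ENNReal.ofReal (t ^ 2) ∂(hA.pvm.scalarMeasure u) < ⊤) : u ∈ A.domain := by
  set π := cfcHom (R := ℝ) hA.isSelfAdjoint
  rw [hA.lintegral_scalarMeasure_pvm _ (by fun_prop)] at hu
  have hg : MemLp (invSubOne (S := spectrum ℝ R)) 2 (spectralMeasure π u) := by
    refine ⟨measurable_invSubOne.aestronglyMeasurable, ?_⟩
    rw [eLpNorm_lt_top_iff_lintegral_rpow_enorm_lt_top (by simp) (by simp)]
    refine lt_of_eq_of_lt (lintegral_congr fun x => ?_) hu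
    rw [← Real.enorm_of_nonneg (sq_nonneg _), enorm_pow]
    simp
  have hinv : MemLp (fun x : spectrum ℝ R => (x : ℝ)⁻¹) 2 (spectralMeasure π u) :=
    (hg.add (memLp_const 1)).ae_eq (ae_of_all _ fun x => sub_add_cancel _ _)
  have hR := map_spectralMap π u (spectrumCoord R) (h := hinv.toLp)
    (h' := ContinuousMap.toLp 2 (spectralMeasure π u) ℝ 1) (by
      filter_upwards [ContinuousMap.coeFn_toLp (p := 2) (𝕜 := ℝ) (spectralMeasure π u)
          (1 : C(spectrum ℝ R, ℝ)), hinv.coeFn_toLp, hA.ae_ne_zero u] with x h1 h2 hx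
      rw [h1, h2, ContinuousMap.one_apply, spectrumCoord_apply, mul_inv_cancel₀ hx])
  rw [cfcHom_spectrumCoord, spectralMap_toLp, map_one, one_apply_eq_self] at hR
  refine LinearPMap.mem_domain_of_mem_graph
    ((hA.mem_graph_iff u (spectralMap π u hinv.toLp - u)).2 ?_)
  rw [add_sub_cancel, hR]

theorem inner_eq_integral_scalarMeasure_pvm {u w : H} (huw : (u, w) ∈ A.graph) :
    inner ℂ u w = ((∫ t, t ∂(hA.pvm.scalarMeasure u) : ℝ) : ℂ) := by
  set π := cfcHom (R := ℝ) hA.isSelfAdjoint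
  let φ := spectrumCoord R
  have hinner : inner ℂ u w = inner ℂ (u + w) (π (φ * (1 - φ)) (u + w)) := by
    rw [map_mul_apply, ← inner_map_left, hA.eq_cfcHom_spectrumCoord huw,
      hA.eq_cfcHom_one_sub_spectrumCoord huw]
  have hint : ∫ t, t ∂(hA.pvm.scalarMeasure u)
      = ∫ x, (φ * (1 - φ)) x ∂(spectralMeasure π (u + w)) := by
    rw [pvm, scalarMeasure_spectralPVM, integral_map measurable_invSubOne.aemeasurable
      (by fun_prop)]
    have hu := spectralMeasure_map π (u + w) φ
    rw [hA.eq_cfcHom_spectrumCoord huw] at hu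
    rw [hu, integral_withDensity_eq_integral_toReal_smul (by fun_prop) (by simp)]
    refine integral_congr_ae ?_
    filter_upwards [hA.ae_ne_zero (u + w)] with x hx
    simp only [ENNReal.toReal_ofReal (sq_nonneg _), smul_eq_mul, ContinuousMap.mul_apply,
      ContinuousMap.sub_apply, ContinuousMap.one_apply, φ, spectrumCoord_apply, invSubOne]
    field_simp
  rw [hint, integral_spectralMeasure, hinner, ofReal_re_inner_of_isSelfAdjoint
    (isSelfAdjoint_map π _)]

theorem isSpectralResolution : hA.pvm.IsSpectralResolution A :=
  ⟨fun u => ⟨fun hu => hA.lintegral_sq_lt_top_of_mem_graph (A.mem_graph ⟨u, hu⟩),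
    hA.mem_domain_of_lintegral_sq_lt_top⟩,
    fun u => hA.inner_eq_integral_scalarMeasure_pvm (A.mem_graph u)⟩

end IsSelfAdjointResolvent

end Resolvent

/-! ### The resolvent of a non-negative self-adjoint operator -/

theorem graph_closure_le_topologicalClosure {E F : Type*} [NormedAddCommGroup E]
    [NormedSpace ℂ E] [NormedAddCommGroup F] [NormedSpace ℂ F] (T : E →ₗ.[ℂ] F) :
    T.closure.graph ≤ T.graph.topologicalClosure := by
  by_cases h : T.IsClosable
  · exact h.graph_closure_eq_closure_graph.ge
  · rw [LinearPMap.closure_def' h]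
    exact T.graph.le_topologicalClosure

section Nonnegative

variable {H : Type*} [NormedAddCommGroup H] [InnerProductSpace ℂ H] {T : H →ₗ.[ℂ] H}

theorem IsNonnegative.re_inner_nonneg (hT : IsNonnegative T) {u w : H} (huw : (u, w) ∈ T.graph) :
    0 ≤ (inner ℂ w u).re := by
  obtain ⟨z, rfl, rfl⟩ := T.mem_graph_iff.1 huw
  exact hT z

theorem IsNonnegative.closure (hT : IsNonnegative T) : IsNonnegative T.closure := by
  have hclosed : IsClosed {p : H × H | 0 ≤ (inner ℂ p.2 p.1).re} :=
    isClosed_le continuous_const (Complex.continuous_re.comp (continuous_snd.inner continuous_fst))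
  exact fun u => closure_minimal (fun _ hp => hT.re_inner_nonneg hp) hclosed
    (graph_closure_le_topologicalClosure T (T.closure.mem_graph u))

theorem IsNonnegative.norm_le_norm_add (hT : IsNonnegative T) {p : H × H} (hp : p ∈ T.graph) :
    ‖p‖ ≤ ‖p.1 + p.2‖ := by
  have hsq := norm_add_sq (𝕜 := ℂ) p.2 p.1
  have hre : 0 ≤ RCLike.re (inner ℂ p.2 p.1) := hT.re_inner_nonneg hp
  rw [add_comm p.1]
  refine max_le ?_ ?_ <;> refine le_of_sq_le_sq ?_ (norm_nonneg _) <;>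
    nlinarith [sq_nonneg ‖p.1‖, sq_nonneg ‖p.2‖]

/-- The bijection `(u, T u) ↦ u + T u` from the graph of `T` onto the whole space whose inverse
yields the resolvent. -/
def oneAddGraph (T : H →ₗ.[ℂ] H) : T.graph →L[ℂ] H :=
  (ContinuousLinearMap.fst ℂ H H + ContinuousLinearMap.snd ℂ H H) ∘L T.graph.subtypeL

@[simp]
theorem oneAddGraph_apply (p : T.graph) : oneAddGraph T p = p.1.1 + p.1.2 := rfl

theorem IsNonnegative.antilipschitzWith_oneAddGraph (hT : IsNonnegative T) :
    AntilipschitzWith 1 (oneAddGraph T) :=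
  (oneAddGraph T).antilipschitz_of_bound fun p => by
    simpa using hT.norm_le_norm_add p.2

end Nonnegative

section SelfAdjoint

variable {H : Type*} [NormedAddCommGroup H] [InnerProductSpace ℂ H] [CompleteSpace H]
  {A T : H →ₗ.[ℂ] H}

theorem mem_graph_iff_of_isSelfAdjoint (hA : IsSelfAdjoint A) {u w : H} :
    (u, w) ∈ A.graph ↔ ∀ a b, (a, b) ∈ A.graph → inner ℂ b u = inner ℂ a w := by
  have hadj := LinearPMap.adjoint_graph_eq_graph_adjoint hA.dense_domain
  rw [LinearPMap.isSelfAdjoint_def.1 hA] at hadj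
  rw [hadj, Submodule.mem_adjoint_iff, ← hadj]
  simp only [sub_eq_zero]

theorem IsEssentiallySelfAdjoint.mem_graph_closure (hT : IsEssentiallySelfAdjoint T) {u w : H}
    (h : ∀ a b, (a, b) ∈ T.graph → inner ℂ b u = inner ℂ a w) : (u, w) ∈ T.closure.graph := by
  have hclosed : IsClosed {p : H × H | inner ℂ p.2 u = inner ℂ p.1 w} :=
    isClosed_eq (continuous_snd.inner continuous_const) (continuous_fst.inner continuous_const)
  exact (mem_graph_iff_of_isSelfAdjoint hT.2).2 fun a b hab =>
    closure_minimal (fun p hp => h p.1 p.2 hp) hclosed (graph_closure_le_topologicalClosure T hab)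

theorem range_oneAddGraph (hA : IsSelfAdjoint A) (hpos : IsNonnegative A) :
    (oneAddGraph A).range = ⊤ := by
  have : CompleteSpace A.graph := hA.isClosed.completeSpace_coe
  have hclosed : IsClosed ((oneAddGraph A).range : Set H) :=
    (hpos.antilipschitzWith_oneAddGraph).isClosed_range (oneAddGraph A).uniformContinuous
  have : CompleteSpace (oneAddGraph A).range := hclosed.completeSpace_coe
  rw [← Submodule.orthogonal_eq_bot_iff, Submodule.eq_bot_iff]
  intro v hv
  have hgraph : (v, -v) ∈ A.graph := by
    refine (mem_graph_iff_of_isSelfAdjoint hA).2 fun a b hab => ?_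
    have horth : inner ℂ (a + b) v = 0 := hv _ ⟨⟨(a, b), hab⟩, rfl⟩
    rw [inner_add_left] at horth
    rw [inner_neg_right]
    exact eq_neg_of_add_eq_zero_right horth
  have hnorm := hpos.norm_le_norm_add hgraph
  rw [add_neg_cancel, norm_zero, norm_le_zero_iff] at hnorm
  exact congrArg Prod.fst hnorm

theorem exists_isSelfAdjointResolvent (hA : IsSelfAdjoint A) (hpos : IsNonnegative A) :
    ∃ R : H →L[ℂ] H, IsSelfAdjointResolvent A R := by
  have : CompleteSpace A.graph := hA.isClosed.completeSpace_coe
  let e := ContinuousLinearEquiv.ofBijective (oneAddGraph A)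
    (LinearMap.ker_eq_bot.2 (hpos.antilipschitzWith_oneAddGraph).injective)
    (range_oneAddGraph hA hpos)
  have he (p : A.graph) : e p = p.1.1 + p.1.2 := rfl
  refine ⟨ContinuousLinearMap.fst ℂ H H ∘L A.graph.subtypeL ∘L e.symm,
    ContinuousLinearMap.isSelfAdjoint_iff_isSymmetric.2 fun f g => ?_, fun u w => ⟨fun huw => ?_,
      fun huw => ?_⟩⟩
  · obtain ⟨p, rfl⟩ := e.surjective f
    obtain ⟨q, rfl⟩ := e.surjective g
    have hpq := (mem_graph_iff_of_isSelfAdjoint hA).1 q.2 _ _ p.2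
    change inner ℂ (e.symm (e p)).1.1 (e q) = inner ℂ (e p) (e.symm (e q)).1.1
    rw [e.symm_apply_apply, e.symm_apply_apply, he, he, inner_add_left, inner_add_right, hpq]
  · exact congrArg (fun p : A.graph => p.1.1) (e.symm_apply_apply ⟨(u, w), huw⟩)
  · obtain ⟨p, hp⟩ := e.surjective (u + w)
    change (e.symm (u + w)).1.1 = u at huw
    rw [← hp, e.symm_apply_apply] at huw
    rw [he, huw, add_right_inj] at hp
    rw [← huw, ← hp]
    exact p.2

end SelfAdjoint

/-! ### Exponential integrability from factorial moment bounds -/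

/- Otherwise every term of the series of `cosh y` would be less than `exp y / 4 ^ (k + 1)`, and
`cosh y ≤ exp y / 3` would follow. -/
theorem exists_exp_le_four_mul_pow_div_factorial (y : ℝ) :
    ∃ k : ℕ, Real.exp y ≤ 4 * ((2 * y) ^ (2 * k) / (2 * k).factorial) := by
  by_contra! h
  have hgeom : HasSum (fun k : ℕ => Real.exp y / 4 * (1 / 4) ^ k) (Real.exp y / 4 * (4 / 3)) := by
    rw [show (4 / 3 : ℝ) = (1 - 1 / 4)⁻¹ by norm_num]
    exact (hasSum_geometric_of_lt_one (by norm_num) (by norm_num)).mul_left _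
  have hcosh : Real.cosh y ≤ Real.exp y / 4 * (4 / 3) := by
    refine hasSum_le (fun k => ?_) (Real.hasSum_cosh y) hgeom
    have hterm : y ^ (2 * k) / (2 * k).factorial
        = (2 * y) ^ (2 * k) / (2 * k).factorial * (1 / 4) ^ k := by
      rw [mul_pow, pow_mul 2 2 k, mul_div_right_comm, mul_assoc, mul_comm (y ^ _),
        ← mul_assoc, div_mul_eq_mul_div, ← mul_pow]
      norm_num [div_eq_inv_mul]
    rw [hterm]
    exact mul_le_mul_of_nonneg_right (by linarith [h k]) (by positivity)
  rw [Real.cosh_eq] at hcosh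
  linarith [Real.exp_pos y, Real.exp_pos (-y)]

theorem exists_exp_rpow_le_pow_div_factorial_rpow {p x : ℝ} (hp : 0 < p) (hx : 0 ≤ x) :
    ∃ k : ℕ, Real.exp (p / 2 * x ^ (1 / p))
      ≤ 4 ^ p * (x ^ (2 * k) / ((2 * k).factorial : ℝ) ^ p) := by
  obtain ⟨k, hk⟩ := exists_exp_le_four_mul_pow_div_factorial (x ^ (1 / p) / 2)
  refine ⟨k, ?_⟩
  rw [mul_div_cancel₀ _ two_ne_zero] at hk
  calc Real.exp (p / 2 * x ^ (1 / p))
      = Real.exp (x ^ (1 / p) / 2) ^ p := by rw [← Real.exp_mul]; ring_nf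
    _ ≤ (4 * ((x ^ (1 / p)) ^ (2 * k) / (2 * k).factorial)) ^ p := by gcongr
    _ = 4 ^ p * (x ^ (2 * k) / ((2 * k).factorial : ℝ) ^ p) := by
        rw [Real.mul_rpow (by positivity) (by positivity),
          Real.div_rpow (by positivity) (by positivity), ← Real.rpow_pow_comm (by positivity),
          ← Real.rpow_mul hx, one_div_mul_cancel hp.ne', Real.rpow_one]

theorem lintegral_exp_rpow_lt_top {ν : Measure ℝ} {p B c : ℝ} (hp : 0 < p) (hB : 0 < B)
    (hν : ∀ k : ℕ, ∫⁻ t, ENNReal.ofReal (t ^ (2 * k)) ∂ν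
      ≤ ENNReal.ofReal (c * B ^ (2 * k) * ((2 * k).factorial : ℝ) ^ p)) :
    ∫⁻ t, ENNReal.ofReal (Real.exp (p / 2 * (|t| / (2 * B)) ^ (1 / p))) ∂ν < ⊤ := by
  let a (k : ℕ) : ℝ := 4 ^ p / ((2 * B) ^ (2 * k) * ((2 * k).factorial : ℝ) ^ p)
  have hpointwise (t : ℝ) : ENNReal.ofReal (Real.exp (p / 2 * (|t| / (2 * B)) ^ (1 / p)))
      ≤ ∑' k, ENNReal.ofReal (a k) * ENNReal.ofReal (t ^ (2 * k)) := by
    obtain ⟨k, hk⟩ := exists_exp_rpow_le_pow_div_factorial_rpow hp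
      (x := |t| / (2 * B)) (by positivity)
    refine le_trans ?_ (ENNReal.le_tsum k)
    rw [← ENNReal.ofReal_mul (by positivity)]
    refine ENNReal.ofReal_le_ofReal (hk.trans_eq ?_)
    rw [div_pow, (even_two_mul k).pow_abs]
    ring
  have hterm (k : ℕ) : ∫⁻ t, ENNReal.ofReal (a k) * ENNReal.ofReal (t ^ (2 * k)) ∂ν
      ≤ ENNReal.ofReal (4 ^ p * c) * ENNReal.ofReal (1 / 4) ^ k := by
    rw [lintegral_const_mul _ (by fun_prop), ← ENNReal.ofReal_pow (by norm_num),
      ← ENNReal.ofReal_mul' (by positivity)]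
    refine (mul_le_mul_right (hν k) _).trans_eq ?_
    rw [← ENNReal.ofReal_mul (by positivity)]
    congr 1
    rw [one_div_pow, show (4 : ℝ) ^ k = 2 ^ (2 * k) by rw [pow_mul]; norm_num]
    simp only [a]
    field_simp
    ring
  calc _ ≤ ∫⁻ t, ∑' k, ENNReal.ofReal (a k) * ENNReal.ofReal (t ^ (2 * k)) ∂ν :=
        lintegral_mono hpointwise
    _ = ∑' k, ∫⁻ t, ENNReal.ofReal (a k) * ENNReal.ofReal (t ^ (2 * k)) ∂ν :=
        lintegral_tsum fun k => by fun_prop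
    _ ≤ ∑' k : ℕ, ENNReal.ofReal (4 ^ p * c) * ENNReal.ofReal (1 / 4) ^ k :=
        ENNReal.tsum_le_tsum hterm
    _ < ⊤ := by
        rw [ENNReal.tsum_mul_left, ENNReal.tsum_geometric]
        refine ENNReal.mul_lt_top ENNReal.ofReal_lt_top ?_
        rw [ENNReal.inv_lt_top, tsub_pos_iff_lt]
        norm_num

theorem sq_exp_mul_rpow_le {s q : ℝ} (hs : 0 < s) (hq : 0 ≤ q) (t : ℝ) :
    Real.exp (s / 2 * q ^ (1 / (2 * s)) * t ^ (1 / (2 * s))) ^ 2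
      ≤ Real.exp (2 * s / 2 * (|t| * q) ^ (1 / (2 * s))) := by
  rw [← Real.exp_nat_mul, Real.exp_le_exp, Real.mul_rpow (abs_nonneg t) hq]
  have habs : t ^ (1 / (2 * s)) ≤ |t| ^ (1 / (2 * s)) :=
    (le_abs_self _).trans (Real.abs_rpow_le_abs_rpow t _)
  calc (2 : ℕ) * (s / 2 * q ^ (1 / (2 * s)) * t ^ (1 / (2 * s)))
      = s * q ^ (1 / (2 * s)) * t ^ (1 / (2 * s)) := by push_cast; ring
    _ ≤ s * q ^ (1 / (2 * s)) * |t| ^ (1 / (2 * s)) := by gcongr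
    _ = 2 * s / 2 * (|t| ^ (1 / (2 * s)) * q ^ (1 / (2 * s))) := by ring

theorem exists_memCalculusDomain_exp_rpow {H : Type*} [NormedAddCommGroup H]
    [InnerProductSpace ℂ H] [CompleteSpace H] {A : H →ₗ.[ℂ] H} (hA : IsSelfAdjoint A)
    (hpos : IsNonnegative A) {v : ℕ → H} (hv : ∀ k, (v k, v (k + 1)) ∈ A.graph) {s B C : ℝ}
    (hs : 0 < s) (hB : 0 < B)
    (hbound : ∀ k, ‖v k‖ ≤ C * B ^ k * ((2 * k).factorial : ℝ) ^ s) :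
    ∃ D : ℝ, 0 < D ∧ MemCalculusDomain A (fun t => Real.exp (D * t ^ (1 / (2 * s)))) (v 0) := by
  obtain ⟨R, hR⟩ := exists_isSelfAdjointResolvent hA hpos
  have hmoment (k : ℕ) : ∫⁻ t, ENNReal.ofReal (t ^ (2 * k)) ∂(hR.pvm.scalarMeasure (v 0))
      ≤ ENNReal.ofReal (C ^ 2 * B ^ (2 * k) * ((2 * k).factorial : ℝ) ^ (2 * s)) := by
    rw [hR.lintegral_pow_scalarMeasure_pvm hv]
    refine ENNReal.ofReal_le_ofReal ((pow_le_pow_left₀ (norm_nonneg _) (hbound k) 2).trans_eq ?_)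
    rw [mul_pow, mul_pow, ← pow_mul, mul_comm k 2, mul_comm 2 s, Real.rpow_mul (by positivity),
      Real.rpow_two]
  refine ⟨s / 2 * (2 * B)⁻¹ ^ (1 / (2 * s)), by positivity, hR.pvm, hR.isSpectralResolution, ?_⟩
  refine (lintegral_mono fun t => ENNReal.ofReal_le_ofReal
    (sq_exp_mul_rpow_le hs (by positivity) t)).trans_lt ?_
  simpa only [div_eq_mul_inv |_| _] using lintegral_exp_rpow_lt_top (by positivity) hB hmoment

/-! ### The sub-Laplacian as a differential operator -/

section Differential

variable {n r : ℕ} {M : Type*} [TopologicalSpace M] [ChartedSpace (EuclideanSpace ℝ (Fin n)) M]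

theorem isSmooth_zero : IsSmooth n (0 : M → ℂ) := contMDiff_const

theorem lieD_neg (V : (x : M) → TangentSpace (𝓡 n) x) (f : M → ℂ) :
    lieD V (-f) = -lieD V f := by
  funext x
  simp only [lieD, mvfderiv_neg, Pi.neg_apply]
  rfl

theorem lieD_eventuallyEq (V : (x : M) → TangentSpace (𝓡 n) x) {f g : M → ℂ} {x : M}
    (h : f =ᶠ[𝓝 x] g) : lieD V f =ᶠ[𝓝 x] lieD V g := by
  filter_upwards [h.eventuallyEq_nhds] with y hy
  exact DFunLike.congr_fun hy.mfderiv_eq (V y)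

theorem IsSmooth.exists_hasCompactSupport_eventuallyEq [IsManifold (𝓡 n) ∞ M] [T2Space M]
    [SecondCountableTopology M] {f : M → ℂ} (hf : IsSmooth n f) {K : Set M} (hK : IsCompact K) :
    ∃ g : M → ℂ, IsSmooth n g ∧ HasCompactSupport g ∧ ∀ x ∈ K, g =ᶠ[𝓝 x] f := by
  have : LocallyCompactSpace M := Manifold.locallyCompact_of_finiteDimensional (𝓡 n)
  obtain ⟨K', hK', hKK'⟩ := exists_compact_superset hK
  obtain ⟨χ, hχ_one, hχ_zero, -⟩ := exists_contMDiffMap_one_nhds_of_subset_interior (𝓡 n)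
    (n := (⊤ : ℕ∞)) hK.isClosed hKK'
  refine ⟨fun x => χ x • f x, ContMDiff.smul χ.contMDiff hf,
    HasCompactSupport.intro hK' fun x hx => ?_, fun x hx => ?_⟩
  · rw [hχ_zero x hx, zero_smul]
  · filter_upwards [eventually_nhdsSet_iff_forall.1 hχ_one x hx] with y hy
    rw [hy, one_smul]

variable [IsManifold (𝓡 n) ∞ M]

theorem lieD_sum (V : (x : M) → TangentSpace (𝓡 n) x) {ι : Type*} (t : Finset ι)
    {f : ι → M → ℂ} (hf : ∀ i, IsSmooth n (f i)) :
    lieD V (∑ i ∈ t, f i) = ∑ i ∈ t, lieD V (f i) := by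
  classical
  induction t using Finset.induction_on with
  | empty => simpa using lieD_smul (V := V) 0 (isSmooth_zero (n := n))
  | insert a t ha ih =>
    rw [Finset.sum_insert ha, Finset.sum_insert ha, lieD_add (hf a), ih]
    exact contMDiff_finsetSum' fun i _ => hf i

variable (X : HormanderSystem n r M)

theorem lap_eventuallyEq {f g : M → ℂ} {x : M} (h : f =ᶠ[𝓝 x] g) :
    lap X f =ᶠ[𝓝 x] lap X g := by
  have hj (j : Fin r) := lieD_eventuallyEq (X.field j) (lieD_eventuallyEq (X.field j) h)
  filter_upwards [eventually_all.2 hj] with y hy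
  simp only [lap, hy]

theorem lap_zero : lap X (0 : M → ℂ) = 0 := by
  simpa using isSmooth_zero.lap_smul X 0

theorem support_lap_subset_tsupport (f : M → ℂ) : Function.support (lap X f) ⊆ tsupport f := by
  intro x
  contrapose!
  intro hx
  rw [Function.notMem_support,
    (lap_eventuallyEq X (notMem_tsupport_iff_eventuallyEq.1 hx)).eq_of_nhds, lap_zero,
    Pi.zero_apply]

variable {X}

protected theorem IsSmooth.wordD {f : M → ℂ} (hf : IsSmooth n f) (w : List (Fin r)) :
    IsSmooth n (wordD X w f) := by
  induction w with
  | nil => exact hf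
  | cons j w ih => exact ih.lieD (X.smooth j)

protected theorem IsSmooth.lap {f : M → ℂ} (hf : IsSmooth n f) : IsSmooth n (lap X f) :=
  (contMDiff_finsetSum fun j _ => (hf.lieD (X.smooth j)).lieD (X.smooth j)).neg

theorem IsSmooth.iterate_lap {f : M → ℂ} (hf : IsSmooth n f) (k : ℕ) :
    IsSmooth n ((lap X)^[k] f) :=
  Function.Iterate.rec (IsSmooth n) hf (fun _ hg => hg.lap) k

theorem IsSmooth.wordD_lap {f : M → ℂ} (hf : IsSmooth n f) (w : List (Fin r)) :
    wordD X w (lap X f) = -∑ j, wordD X (w ++ [j, j]) f := by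
  induction w with
  | nil =>
    funext x
    simp [lap, wordD]
  | cons i w ih =>
    rw [wordD, ih, lieD_neg, lieD_sum _ _ fun j => hf.wordD _]
    rfl

end Differential

/-! ### The closure of the sub-Laplacian on smooth square-integrable functions -/

theorem inner_congr_of_eqOn_support {α : Type*} [MeasurableSpace α] {μ : Measure α}
    {a u v : Lp ℂ 2 μ} {ψ f g : α → ℂ} (ha : a =ᵐ[μ] ψ) (hu : u =ᵐ[μ] f) (hv : v =ᵐ[μ] g)
    (hfg : EqOn f g (Function.support ψ)) : inner ℂ a u = inner ℂ a v := by
  rw [L2.inner_def, L2.inner_def]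
  refine integral_congr_ae ?_
  filter_upwards [ha, hu, hv] with x hax hux hvx
  rw [hax, hux, hvx]
  by_cases hx : ψ x = 0
  · rw [hx, inner_zero_left, inner_zero_left]
  · rw [hfg hx]

section Closure

variable {n r : ℕ} {M : Type*} [TopologicalSpace M] [ChartedSpace (EuclideanSpace ℝ (Fin n)) M]
  [IsManifold (𝓡 n) ∞ M] [MeasurableSpace M] {X : HormanderSystem n r M} {μ : Measure M}

theorem LapWellDefined.graph_lapOp (h : LapWellDefined X μ) :
    (lapOp X μ).graph = lapGraph X μ := by
  refine Submodule.toLinearPMap_graph_eq _ ?_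
  rintro ⟨u, w⟩ ⟨f, hf, hfc, hu, hw⟩ hu0
  exact Lp.eq_zero_iff_ae_eq_zero.2
    (hw.trans (h f hf hfc (hu.symm.trans (Lp.eq_zero_iff_ae_eq_zero.1 hu0))))

theorem LapEssentiallySelfAdjoint.inner_comm (h : LapEssentiallySelfAdjoint X μ)
    {u w u' w' : Lp ℂ 2 μ} (huw : (u, w) ∈ lapGraph X μ) (huw' : (u', w') ∈ lapGraph X μ) :
    inner ℂ w u' = inner ℂ u w' := by
  have hle := LinearPMap.le_graph_of_le (lapOp X μ).le_closure
  rw [h.wellDefined.graph_lapOp] at hle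
  exact (mem_graph_iff_of_isSelfAdjoint h.essentiallySelfAdjoint.2).1 (hle huw') u w (hle huw)

/- By essential self-adjointness it suffices to pair with a test function `ψ`, and then `f` may be
replaced by a test function that agrees with `f` near the support of `ψ`. -/
theorem LapEssentiallySelfAdjoint.toLp_mem_graph_closure [T2Space M] [SecondCountableTopology M]
    [OpensMeasurableSpace M] [IsFiniteMeasureOnCompacts μ] (h : LapEssentiallySelfAdjoint X μ)
    {f : M → ℂ} (hf : IsSmooth n f) (hf₂ : MemLp f 2 μ) (hlap₂ : MemLp (lap X f) 2 μ) :
    (hf₂.toLp, hlap₂.toLp) ∈ (lapOp X μ).closure.graph := by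
  refine h.essentiallySelfAdjoint.mem_graph_closure fun a b hab => ?_
  rw [h.wellDefined.graph_lapOp] at hab
  obtain ⟨ψ, -, hψc, ha, hb⟩ := id hab
  obtain ⟨g, hg, hgc, hgf⟩ := hf.exists_hasCompactSupport_eventuallyEq hψc
  have hlapgc : HasCompactSupport (lap X g) := hgc.mono' (support_lap_subset_tsupport X g)
  have hg₂ : MemLp g 2 μ := hg.continuous.memLp_of_hasCompactSupport hgc
  have hlapg₂ : MemLp (lap X g) 2 μ := hg.lap.continuous.memLp_of_hasCompactSupport hlapgc
  calc inner ℂ b hf₂.toLp = inner ℂ b hg₂.toLp :=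
        inner_congr_of_eqOn_support hb hf₂.coeFn_toLp hg₂.coeFn_toLp fun x hx =>
          (hgf x (support_lap_subset_tsupport X ψ hx)).eq_of_nhds.symm
    _ = inner ℂ a hlapg₂.toLp :=
        h.inner_comm hab ⟨g, hg, hgc, hg₂.coeFn_toLp, hlapg₂.coeFn_toLp⟩
    _ = inner ℂ a hlap₂.toLp :=
        inner_congr_of_eqOn_support ha hlapg₂.coeFn_toLp hlap₂.coeFn_toLp fun x hx =>
          (lap_eventuallyEq X (hgf x (subset_tsupport ψ hx))).eq_of_nhds

theorem LapEssentiallySelfAdjoint.mem_expSpace [T2Space M] [SecondCountableTopology M]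
    [OpensMeasurableSpace M] [IsFiniteMeasureOnCompacts μ] (h : LapEssentiallySelfAdjoint X μ)
    (hpos : IsNonnegative (lapOp X μ)) {φ : M → ℂ} (hφ : IsSmooth n φ) {s B C : ℝ} (hs : 0 < s)
    (hB : 0 < B) (hC : 0 ≤ C) (hbound : ∀ k, eLpNorm ((lap X)^[k] φ) 2 μ
      ≤ ENNReal.ofReal (C * B ^ k * ((2 * k).factorial : ℝ) ^ s)) :
    φ ∈ expSpace X μ s := by
  have hmem (k : ℕ) : MemLp ((lap X)^[k] φ) 2 μ :=
    ⟨(hφ.iterate_lap k).continuous.aestronglyMeasurable,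
      (hbound k).trans_lt ENNReal.ofReal_lt_top⟩
  have horbit (k : ℕ) : ((hmem k).toLp, (hmem (k + 1)).toLp) ∈ (lapOp X μ).closure.graph := by
    have hlap : MemLp (lap X ((lap X)^[k] φ)) 2 μ := by
      simpa only [Function.iterate_succ_apply'] using hmem (k + 1)
    simpa only [Function.iterate_succ_apply'] using
      h.toLp_mem_graph_closure (hφ.iterate_lap k) (hmem k) hlap
  have hnorm (k : ℕ) : ‖(hmem k).toLp‖ ≤ C * B ^ k * ((2 * k).factorial : ℝ) ^ s := by
    rw [Lp.norm_toLp]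
    exact ENNReal.toReal_le_of_le_ofReal (by positivity) (hbound k)
  obtain ⟨D, hD, hexp⟩ := exists_memCalculusDomain_exp_rpow h.essentiallySelfAdjoint.2
    hpos.closure horbit hs hB hnorm
  exact ⟨hφ, D, hD, (hmem 0).toLp, (hmem 0).coeFn_toLp, hexp⟩

/-! ### Gevrey bounds for the iterates of the sub-Laplacian -/

theorem IsSmooth.eLpNorm_wordD_iterate_lap_le [OpensMeasurableSpace M] {φ : M → ℂ}
    (hφ : IsSmooth n φ) {b : ℕ → ENNReal}
    (hb : ∀ w, eLpNorm (wordD X w φ) 2 μ ≤ b w.length) (k : ℕ) (w : List (Fin r)) :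
    eLpNorm (wordD X w ((lap X)^[k] φ)) 2 μ
      ≤ (r : ENNReal) ^ k * b (w.length + 2 * k) := by
  induction k generalizing w with
  | zero => simpa using hb w
  | succ k ih =>
    have hsmooth : IsSmooth n ((lap X)^[k] φ) := hφ.iterate_lap k
    have hword (j : Fin r) : eLpNorm (wordD X (w ++ [j, j]) ((lap X)^[k] φ)) 2 μ
        ≤ (r : ENNReal) ^ k * b (w.length + 2 * (k + 1)) := by
      refine (ih _).trans_eq ?_
      rw [List.length_append, List.length_cons, List.length_singleton]
      ring_nf
    rw [Function.iterate_succ_apply', hsmooth.wordD_lap w, eLpNorm_neg]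
    calc _ ≤ ∑ j, eLpNorm (wordD X (w ++ [j, j]) ((lap X)^[k] φ)) 2 μ :=
          eLpNorm_sum_le (fun j _ => (hsmooth.wordD _).continuous.aestronglyMeasurable)
            one_le_two
      _ ≤ ∑ _j : Fin r, (r : ENNReal) ^ k * b (w.length + 2 * (k + 1)) :=
          Finset.sum_le_sum fun j _ => hword j
      _ = (r : ENNReal) ^ (k + 1) * b (w.length + 2 * (k + 1)) := by
          rw [Finset.sum_const, Finset.card_univ, Fintype.card_fin, nsmul_eq_mul, ← mul_assoc,
            pow_succ']

theorem sum_count_eq_length (w : List (Fin r)) : ∑ k, w.count k = w.length := by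
  simpa using Multiset.sum_count_eq_card (s := Finset.univ) (m := (w : Multiset (Fin r)))
    fun a _ => Finset.mem_univ a

theorem prod_factorial_count_le (w : List (Fin r)) :
    ∏ k, (w.count k).factorial ≤ w.length.factorial := by
  rw [← sum_count_eq_length w]
  exact Nat.le_of_dvd (Nat.factorial_pos _) (Nat.prod_factorial_dvd_factorial_sum _ _)

theorem exists_eLpNorm_wordD_le_of_mem_gevreyL2 {φ : M → ℂ} {s : ℝ} (hs : 0 ≤ s)
    (hφ : φ ∈ gevreyL2 X μ s) :
    ∃ A C : ℝ, 0 < A ∧ 0 < C ∧ ∀ w, eLpNorm (wordD X w φ) 2 μ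
      ≤ ENNReal.ofReal (C * A ^ w.length * (w.length.factorial : ℝ) ^ s) := by
  obtain ⟨-, A, C, hA, hC, hbound⟩ := hφ
  refine ⟨A, C, hA, hC, fun w => (hbound (w.count ·) w fun _ => rfl).trans ?_⟩
  rw [sum_count_eq_length]
  gcongr
  exact prod_factorial_count_le w

theorem exists_eLpNorm_iterate_lap_le_of_mem_gevreyL2 [OpensMeasurableSpace M] {φ : M → ℂ}
    {s : ℝ} (hs : 0 ≤ s) (hφ : φ ∈ gevreyL2 X μ s) :
    ∃ B C : ℝ, 0 < B ∧ 0 < C ∧ ∀ k, eLpNorm ((lap X)^[k] φ) 2 μ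
      ≤ ENNReal.ofReal (C * B ^ k * ((2 * k).factorial : ℝ) ^ s) := by
  obtain ⟨A, C, hA, hC, hword⟩ := exists_eLpNorm_wordD_le_of_mem_gevreyL2 hs hφ
  refine ⟨(r + 1) * A ^ 2, C, by positivity, hC, fun k => ?_⟩
  calc eLpNorm ((lap X)^[k] φ) 2 μ
      ≤ (r : ENNReal) ^ k
          * ENNReal.ofReal (C * A ^ (2 * k) * ((2 * k).factorial : ℝ) ^ s) := by
        simpa [wordD] using hφ.1.eLpNorm_wordD_iterate_lap_le
          (b := fun N => ENNReal.ofReal (C * A ^ N * (N.factorial : ℝ) ^ s)) hword k []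
    _ = ENNReal.ofReal (r ^ k * (C * A ^ (2 * k) * ((2 * k).factorial : ℝ) ^ s)) := by
        rw [ENNReal.ofReal_mul (p := (r : ℝ) ^ k) (by positivity),
          ENNReal.ofReal_pow (by positivity), ENNReal.ofReal_natCast]
    _ ≤ ENNReal.ofReal ((r + 1) ^ k * (C * A ^ (2 * k) * ((2 * k).factorial : ℝ) ^ s)) := by
        gcongr
        exact le_add_of_nonneg_right zero_le_one
    _ = ENNReal.ofReal (C * ((r + 1) * A ^ 2) ^ k * ((2 * k).factorial : ℝ) ^ s) := by
        rw [mul_pow, ← pow_mul]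
        ring_nf

end Closure

end SubGevrey

end

theorem theorem4p5_general {n r : ℕ} {M : Type*} [TopologicalSpace M] [T2Space M]
    [SecondCountableTopology M] [ChartedSpace (EuclideanSpace ℝ (Fin n)) M]
    [IsManifold (𝓡 n) ∞ M] [MeasurableSpace M] [OpensMeasurableSpace M]
    (μ : Measure M) [IsFiniteMeasureOnCompacts μ]
    (X : SubGevrey.HormanderSystem n r M)
    (hesa : SubGevrey.LapEssentiallySelfAdjoint X μ)
    (hnonneg : SubGevrey.IsNonnegative (SubGevrey.lapOp X μ))
    (s : ℝ) (hs : 0 < s) :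
    SubGevrey.gevreyL2 X μ s ⊆ SubGevrey.expSpace X μ s := by
  intro φ hφ
  obtain ⟨B, C, hB, hC, hbound⟩ :=
    SubGevrey.exists_eLpNorm_iterate_lap_le_of_mem_gevreyL2 hs.le hφ
  exact hesa.mem_expSpace hnonneg hφ.1 hs hB hC.le hbound

theorem theorem4p5 {n r : ℕ} {M : Type*} [TopologicalSpace M] [T2Space M]
    [SecondCountableTopology M] [ChartedSpace (EuclideanSpace ℝ (Fin n)) M]
    [IsManifold (𝓡 n) ∞ M] [MeasurableSpace M] [BorelSpace M]
    (μ : Measure M) [IsLocallyFiniteMeasure μ]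
    (X : SubGevrey.HormanderSystem n r M)
    (hSobolev : SubGevrey.SobolevEmbedding X μ)
    (hesa : SubGevrey.LapEssentiallySelfAdjoint X μ)
    (hnonneg : SubGevrey.IsNonnegative (SubGevrey.lapOp X μ))
    (s : ℝ) (hs : 1 ≤ s) :
    SubGevrey.gevreyL2 X μ s ⊆ SubGevrey.expSpace X μ s :=
  theorem4p5_general μ X hesa hnonneg s (zero_lt_one.trans_le hs)
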